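/- Let $d\in\mathbb N$ and let $k:\mathbb{R}^d\times\mathbb{R}^d\to\mathbb{R}$ be a symmetric positive semi-definite kernel whose mixed partial derivatives $\partial_{x_i}\partial_{y_j}k(x,y)$ exist and are continuous, and such that $k$, its first-order partial derivatives $\partial_{x_i}k$, $\partial_{y_j}k$ and the mixed derivatives $\partial_{x_i}\partial_{y_j}k$ ($i,j=1,\dots,d$) are bounded. Let $\mathcal{H}_k$ be the reproducing kernel Hilbert space of $k$, and let $\mathcal{H}_k^d$ be its $d$-fold product, with inner product $\langle u,v\rangle_{\mathcal{H}_k^d}=\sum_{i=1}^d\langle u_i,v_i\rangle_{\mathcal{H}_k}$. Let $\pi\in C^1(\mathbb{R}^d;\mathbb{R})$ be a strictly positive probability density (identified with the corresponding probability measure), and let $h:\mathbb{R}^d\to\mathbb{R}$ be continuous, with $\|h\|_{L^2(\pi)}<\infty$ and $\|\nabla\log\pi\|_{(L^2(\pi))^d}<\infty$. Assume that there are constants $C>0$ and $p>1$ such that $$|\nabla\log\pi(x)|\le C(1+|x|^{p/2})\quad\text{and}\quad |h(x)|\le C(1+|x|^{p/2})\qquad\text{for all }x\in\mathbb{R}^d.$$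 Let $(X^i)_{i=1}^\infty\subset\mathbb{R}^d$ be a sequence of points such that the empirical measures $\frac1N\sum_{i=1}^N\delta_{X^i}$ converge to $\pi$ in the $p$-Wasserstein distance as $N\to\infty$. Write $S_\pi v:=\nabla\log\pi\cdot v+\nabla\cdot v$ and fix $\lambda>0$. Then the functional $$v\mapsto\int_{\mathbb{R}^d}\Big(S_\pi v-h+\int_{\mathbb{R}^d} h\,\mathrm{d}\pi\Big)^2\mathrm{d}\pi+\lambda\|v\|_{\mathcal{H}_k^d}^2$$ has a unique minimiser $v^*_{\infty,\lambda}$ in $\mathcal{H}_k^d$; for every $N\ge1$ the functional $$v\mapsto\frac1N\sum_{j=1}^N\Big((S_\pi v)(X^j)-h(X^j)+\frac1N\sum_{i=1}^N h(X^i)\Big)^2+\lambda\|v\|_{\mathcal{H}_k^d}^2$$ has a unique minimiser $v^*_{N,\lambda}$ in $\mathcal{H}_k^d$; and $$\|v^*_{N,\lambda}-v^*_{\infty,\lambda}\|_{\mathcal{H}_k^d}\longrightarrow0\qquad\text{as }N\to\infty.$$ -/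

import Mathlib

open MeasureTheory Filter Topology

noncomputable section

namespace SteinTransport

/-- Euclidean space `ℝᵈ`. -/
abbrev E (d : ℕ) : Type := EuclideanSpace ℝ (Fin d)

/-- The `i`-th standard basis vector of `ℝᵈ`. -/
abbrev stdVec {d : ℕ} (i : Fin d) : E d := EuclideanSpace.single i (1 : ℝ)

/-! ### Probability densities and the Stein operator -/

/-- `ρ` is a strictly positive, continuously differentiable probability density on `ℝᵈ`. -/
structure IsPosC1Density {d : ℕ} (ρ : E d → ℝ) : Prop where
  contDiff : ContDiff ℝ 1 ρ
  pos : ∀ x, 0 < ρ x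
  lintegral_eq_one : ∫⁻ x, ENNReal.ofReal (ρ x) = 1

/-- The measure with Lebesgue density `ρ`. -/
def densityMeasure {d : ℕ} (ρ : E d → ℝ) : Measure (E d) :=
  volume.withDensity fun x => ENNReal.ofReal (ρ x)

/-- The score function `∇ log ρ`. -/
def score {d : ℕ} (ρ : E d → ℝ) (x : E d) : E d :=
  gradient (fun y => Real.log (ρ y)) x

/-- The divergence `∑ᵢ ∂ᵢ vᵢ`. -/
def divergence {d : ℕ} (v : E d → E d) (x : E d) : ℝ :=
  ∑ i, lineDeriv ℝ (fun y => v y i) x (stdVec i)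

/-- The Stein operator `v ↦ ∇ log ρ · v + ∇ · v`. -/
def steinOp {d : ℕ} (ρ : E d → ℝ) (v : E d → E d) (x : E d) : ℝ :=
  inner ℝ (score ρ x) (v x) + divergence v x

/-! ### Kernels -/

/-- Positive (semi-)definite kernels: symmetric, with nonnegative quadratic forms. -/
structure IsPosDefKernel {d : ℕ} (k : E d → E d → ℝ) : Prop where
  symm : ∀ x y, k x y = k y x
  nonneg : ∀ (n : ℕ) (α : Fin n → ℝ) (x : Fin n → E d),
    0 ≤ ∑ i, ∑ j, α i * α j * k (x i) (x j)

/-- `∂_{xᵢ} k(x, y)`, the partial derivative in the first argument. -/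
def partialFst {d : ℕ} (k : E d → E d → ℝ) (i : Fin d) (x y : E d) : ℝ :=
  lineDeriv ℝ (fun x' => k x' y) x (stdVec i)

/-- `∂_{yⱼ} k(x, y)`, the partial derivative in the second argument. -/
def partialSnd {d : ℕ} (k : E d → E d → ℝ) (j : Fin d) (x y : E d) : ℝ :=
  lineDeriv ℝ (fun y' => k x y') y (stdVec j)

/-- `∂_{xᵢ} ∂_{yⱼ} k(x, y)`, one derivative in each argument. -/
def partialMixed {d : ℕ} (k : E d → E d → ℝ) (i j : Fin d) (x y : E d) : ℝ :=
  lineDeriv ℝ (fun x' => partialSnd k j x' y) x (stdVec i)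

/-- The class `C^{1,1}`: the mixed partial derivatives `∂_{xᵢ} ∂_{yⱼ} k` exist and are
continuous on `ℝᵈ × ℝᵈ`. -/
structure IsC11 {d : ℕ} (k : E d → E d → ℝ) : Prop where
  exists_partialSnd : ∀ (j : Fin d) (x y : E d),
    LineDifferentiableAt ℝ (fun y' => k x y') y (stdVec j)
  exists_partialMixed : ∀ (i j : Fin d) (x y : E d),
    LineDifferentiableAt ℝ (fun x' => partialSnd k j x' y) x (stdVec i)
  continuous_partialMixed : ∀ i j : Fin d,
    Continuous fun z : E d × E d => partialMixed k i j z.1 z.2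

/-- The kernel is bounded, and so are its derivatives of order at most one in each argument:
`∂_{xᵢ} k`, `∂_{yⱼ} k` and `∂_{xᵢ} ∂_{yⱼ} k`. -/
structure IsBoundedC11 {d : ℕ} (k : E d → E d → ℝ) : Prop where
  bounded : ∃ B : ℝ, ∀ x y, |k x y| ≤ B
  bounded_fst : ∃ B : ℝ, ∀ i x y, |partialFst k i x y| ≤ B
  bounded_snd : ∃ B : ℝ, ∀ j x y, |partialSnd k j x y| ≤ B
  bounded_mixed : ∃ B : ℝ, ∀ i j x y, |partialMixed k i j x y| ≤ B

/-! ### Vector fields with components in a reproducing kernel Hilbert space -/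

section RKHS

variable {d : ℕ} (H : Type*) [NormedAddCommGroup H] [InnerProductSpace ℝ H]
  [RKHS ℝ H (E d) ℝ]

/-- The Hilbert space `H` of real functions on `ℝᵈ` is the reproducing kernel Hilbert space
of `k`: it contains every `k(x, ·)`, and `⟨f, k(x, ·)⟩ = f(x)` for all `f ∈ H`. -/
def IsRKHSOf (k : E d → E d → ℝ) : Prop :=
  ∀ x : E d, ∃ kx : H, (∀ y, kx y = k x y) ∧ ∀ f : H, inner ℝ f kx = f x

/-- The `d`-fold product of `H`, with inner product `∑ᵢ ⟨uᵢ, vᵢ⟩`. -/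
abbrev Hd (d : ℕ) (H : Type*) : Type _ := PiLp 2 fun _ : Fin d => H

variable {H}

/-- The vector field `x ↦ (v₁(x), …, v_d(x))` given by `v ∈ Hᵈ`. -/
def toField (v : Hd d H) (x : E d) : E d := WithLp.toLp 2 fun i => (v i : H) x

/-- The finite-sample objective, with the points `X 0, …, X (N - 1)`. -/
def sampleObjective (ρ h : E d → ℝ) (X : ℕ → E d) (N : ℕ) (lam : ℝ) (v : Hd d H) : ℝ :=
  (1 / (N : ℝ)) * ∑ j ∈ Finset.range N,
    (steinOp ρ (toField v) (X j)
      - (h (X j) - (1 / (N : ℝ)) * ∑ i ∈ Finset.range N, h (X i))) ^ 2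
  + lam * ‖v‖ ^ 2

/-- The mean-field objective. -/
def meanFieldObjective (ρ h : E d → ℝ) (lam : ℝ) (v : Hd d H) : ℝ :=
  (∫ x, (steinOp ρ (toField v) x - (h x - ∫ y, h y ∂(densityMeasure ρ))) ^ 2
    ∂(densityMeasure ρ))
  + lam * ‖v‖ ^ 2

end RKHS

/-! ### Empirical measures and the Wasserstein distance -/

/-- The empirical measure of `X 0, …, X (N - 1)`. -/
def empiricalMeasure {d : ℕ} (X : ℕ → E d) (N : ℕ) : Measure (E d) :=
  (N : ENNReal)⁻¹ • ∑ i ∈ Finset.range N, Measure.dirac (X i)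

/-- The `p`-Wasserstein distance, with values in `[0, ∞]`: the infimum over all couplings `γ` of
`(∫ |x - y|^p dγ(x, y))^{1/p}`. -/
def wassersteinDist {d : ℕ} (p : ℝ) (μ ν : Measure (E d)) : ENNReal :=
  (⨅ (γ : Measure (E d × E d)) (_ : γ.map Prod.fst = μ ∧ γ.map Prod.snd = ν),
    ∫⁻ z, ENNReal.ofReal (‖z.1 - z.2‖ ^ p) ∂γ) ^ (1 / p)

end SteinTransport

end

noncomputable section

namespace SteinTransport

/-! ### Line derivatives and the mean value theorem -/

/-! Both objectives are ridge regressions with the same features. The map `x ↦ k(x, ·)` into `H` has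
partial derivatives that represent `f ↦ ∂ᵢ f(x)` (`hasLineDerivAt_feature`, `hasLineDerivAt_rkhs`),
so `S v (x) = ⟨v, φ(x)⟩` with `φ = steinFeature` (`steinOp_toField`). Only the measure and the mean
subtracted from `h` differ.

For a measure `μ`, the minimisers are the zeros of `G_μ(v) = ∫ (⟨v, φ⟩ - g) φ dμ + λ v`
(`isMinOn_ridge_iff`). A zero exists by coercivity, and `λ ‖u - v‖ ≤ ‖G_μ(u) - G_μ(v)‖`
(`mul_norm_sub_le_ridgeGrad`) makes it unique. Taking `μ` empirical, `u = v_N` and `v = v_∞` gives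
`λ ‖v_N - v_∞‖ ≤ ‖G_N(v_∞)‖`. Hence it suffices that `G_N → G_∞` at the single vector `v_∞`. The
integrands there are continuous, `Hᵈ`-valued or real, and of growth at most `1 + ‖x‖ ^ p`, so
Wasserstein convergence applies to them (`tendsto_ridgeGrad`). -/

theorem hasDerivAt_line {V F : Type*} [AddCommGroup V] [Module ℝ V] [NormedAddCommGroup F]
    [NormedSpace ℝ F] {f : V → F} {x v : V} {f' : F} {u : ℝ}
    (hf : HasLineDerivAt ℝ f f' (x + u • v) v) :
    HasDerivAt (fun t : ℝ => f (x + t • v)) f' u := by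
  have h1 : HasDerivAt (fun t : ℝ => f (x + u • v + t • v)) f' (u - u) := by
    rw [sub_self]; exact hf
  have h2 := h1.comp_sub_const u u
  refine h2.congr_of_eventuallyEq (Eventually.of_forall fun t => ?_)
  simp only [add_assoc, ← add_smul, add_sub_cancel]

theorem exists_sub_eq_mul_deriv {f f' : ℝ → ℝ} (hf : ∀ u, HasDerivAt f (f' u) u) (s : ℝ) :
    ∃ b, |b| ≤ |s| ∧ f s - f 0 = s * f' b := by
  have hc : Continuous f := continuous_iff_continuousAt.2 fun u => (hf u).continuousAt
  rcases lt_trichotomy s 0 with hs | rfl | hs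
  · obtain ⟨c, hc1, hc2⟩ := exists_hasDerivAt_eq_slope f f' hs hc.continuousOn fun u _ => hf u
    refine ⟨c, ?_, ?_⟩
    · rw [abs_of_neg hs, abs_of_neg hc1.2]; linarith [hc1.1]
    · rw [hc2]; field_simp; ring
  · exact ⟨0, le_rfl, by simp⟩
  · obtain ⟨c, hc1, hc2⟩ := exists_hasDerivAt_eq_slope f f' hs hc.continuousOn fun u _ => hf u
    refine ⟨c, ?_, ?_⟩
    · rw [abs_of_pos hs, abs_of_pos hc1.1]; linarith [hc1.2]
    · rw [hc2]; field_simp; ring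

/-- The mean value theorem is used twice: in `y` for the increment of `k` in `x`, then in `x` for
`partialSnd k j`. Joint differentiability of `k` is not needed. -/
theorem IsC11.exists_mixed_difference {d : ℕ} {k : E d → E d → ℝ} (hk : IsC11 k) (i j : Fin d)
    (x y : E d) (t s : ℝ) :
    ∃ a b : ℝ, |a| ≤ |t| ∧ |b| ≤ |s| ∧
      k (x + t • stdVec i) (y + s • stdVec j) - k x (y + s • stdVec j)
        - (k (x + t • stdVec i) y - k x y)
      = t * s * partialMixed k i j (x + a • stdVec i) (y + b • stdVec j) := by
  obtain ⟨b, hb, hb'⟩ := exists_sub_eq_mul_deriv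
    (f := fun u => k (x + t • stdVec i) (y + u • stdVec j) - k x (y + u • stdVec j))
    (f' := fun u => partialSnd k j (x + t • stdVec i) (y + u • stdVec j)
      - partialSnd k j x (y + u • stdVec j))
    (fun u => (hasDerivAt_line (f := fun y' => k (x + t • stdVec i) y')
        (hk.exists_partialSnd j _ _).hasLineDerivAt).sub
      (hasDerivAt_line (f := fun y' => k x y') (hk.exists_partialSnd j _ _).hasLineDerivAt)) s
  obtain ⟨a, ha, ha'⟩ := exists_sub_eq_mul_deriv
    (f := fun u => partialSnd k j (x + u • stdVec i) (y + b • stdVec j))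
    (f' := fun u => partialMixed k i j (x + u • stdVec i) (y + b • stdVec j))
    (fun u => hasDerivAt_line (f := fun x' => partialSnd k j x' (y + b • stdVec j))
        (hk.exists_partialMixed i j _ _).hasLineDerivAt) t
  refine ⟨a, b, ha, hb, ?_⟩
  simp only [zero_smul, add_zero] at ha' hb'
  rw [hb', ha']; ring

/-! ### The feature map of a kernel of class `C^{1,1}` -/

section Feature

variable {d : ℕ} (H : Type*) [NormedAddCommGroup H] [InnerProductSpace ℝ H]
  [CompleteSpace H] [RKHS ℝ H (E d) ℝ]

/-- The feature map `x ↦ k(x, ·)`. -/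
def feature (x : E d) : H := RKHS.kerFun H x (1 : ℝ)

/-- The difference quotients of the feature map along the coordinate axes. -/
def featureQuotient (i : Fin d) (x : E d) (t : ℝ) : H :=
  t⁻¹ • (feature H (x + t • stdVec i) - feature H x)

/-- The partial derivatives of the feature map. -/
def featureDeriv (i : Fin d) (x : E d) : H := lineDeriv ℝ (feature H) x (stdVec i)

variable {H}

theorem inner_feature (f : H) (x : E d) : inner ℝ f (feature H x) = f x := by
  simp [feature]

variable {k : E d → E d → ℝ}

theorem IsRKHSOf.inner_feature_feature (hH : IsRKHSOf H k) (x y : E d) :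
    inner ℝ (feature H x) (feature H y) = k x y := by
  obtain ⟨kx, h1, h2⟩ := hH x
  have : kx = feature H x := by
    refine ext_inner_left ℝ fun f => ?_
    rw [h2, inner_feature]
  rw [inner_feature, ← this, h1]

/-- By the reproducing property the inner product is a mixed second difference of `k` divided by `t
s`. The two increments vary independently, as the Cauchy argument below requires. -/
theorem tendsto_inner_featureQuotient (hk : IsC11 k) (hH : IsRKHSOf H k) (i j : Fin d)
    (x y : E d) :
    Tendsto (fun z : ℝ × ℝ => inner ℝ (featureQuotient H i x z.1) (featureQuotient H j y z.2))
      (𝓝[≠] 0 ×ˢ 𝓝[≠] 0) (𝓝 (partialMixed k i j x y)) := by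
  have hcont : Continuous fun z : ℝ × ℝ =>
      partialMixed k i j (x + z.1 • stdVec i) (y + z.2 • stdVec j) :=
    (hk.continuous_partialMixed i j).comp
      (f := fun z : ℝ × ℝ => (x + z.1 • (stdVec i : E d), y + z.2 • (stdVec j : E d)))
      (by fun_prop)
  have hc := hcont.tendsto (0, 0)
  simp only [zero_smul, add_zero] at hc
  rw [Metric.tendsto_nhds]
  intro ε hε
  obtain ⟨δ, hδ, hδ'⟩ := Metric.eventually_nhds_iff.1 (Metric.tendsto_nhds.1 hc ε hε)
  have hev : ∀ᶠ t : ℝ in 𝓝[≠] 0, |t| < δ ∧ t ≠ 0 := by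
    refine Eventually.and ?_ self_mem_nhdsWithin
    refine mem_nhdsWithin_of_mem_nhds (Metric.eventually_nhds_iff.2 ⟨δ, hδ, fun t ht => ?_⟩)
    simpa using ht
  filter_upwards [hev.prod_mk hev] with ⟨t, s⟩ ⟨⟨ht, ht0⟩, hs, hs0⟩
  obtain ⟨a, b, ha, hb, hab⟩ := hk.exists_mixed_difference i j x y t s
  have : inner ℝ (featureQuotient H i x t) (featureQuotient H j y s)
      = partialMixed k i j (x + a • stdVec i) (y + b • stdVec j) := by
    simp only [featureQuotient, inner_smul_left, inner_smul_right, inner_sub_left,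
      inner_sub_right, hH.inner_feature_feature]
    rw [show ∀ p q r u : ℝ, p - q - (r - u) = p - r - (q - u) by intros; ring] at hab
    have h3 := congrArg (fun c => t⁻¹ * (s⁻¹ * c)) hab
    simp only [conj_trivial] at h3 ⊢
    have h4 : t⁻¹ * (s⁻¹ * (t * s * partialMixed k i j (x + a • stdVec i) (y + b • stdVec j)))
      = partialMixed k i j (x + a • stdVec i) (y + b • stdVec j) := by field_simp
    rw [h4] at h3
    rw [← h3]; ring
  rw [this]
  refine hδ' (y := (a, b)) ?_
  rw [Prod.dist_eq]
  simpa using ⟨ha.trans_lt ht, hb.trans_lt hs⟩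

/-- The quotients `q_t` are Cauchy: `‖q_t - q_s‖² = ⟨q_t, q_t⟩ - 2 ⟨q_t, q_s⟩ + ⟨q_s, q_s⟩` tends to
`m - 2m + m = 0`, where `m = ∂ᵢ∂ᵢ k(x, x)`. Completeness of `H` supplies the limit. -/
theorem hasLineDerivAt_feature (hk : IsC11 k) (hH : IsRKHSOf H k) (i : Fin d) (x : E d) :
    HasLineDerivAt ℝ (feature H) (featureDeriv H i x) x (stdVec i) := by
  refine LineDifferentiableAt.hasLineDerivAt ?_
  suffices h : ∃ D, Tendsto (featureQuotient H i x) (𝓝[≠] 0) (𝓝 D) by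
    obtain ⟨D, hD⟩ := h
    refine HasLineDerivAt.lineDifferentiableAt (f' := D) ?_
    rw [HasLineDerivAt, hasDerivAt_iff_tendsto_slope_zero]
    simp only [zero_add, zero_smul, add_zero]
    exact hD
  rw [← cauchy_map_iff_exists_tendsto, cauchy_map_iff]
  refine ⟨inferInstance, ?_⟩
  rw [tendsto_uniformity_iff_dist_tendsto_zero]
  have h := tendsto_inner_featureQuotient hk hH i i x x
  have hdiag : Tendsto (fun t : ℝ => (t, t)) (𝓝[≠] 0) (𝓝[≠] 0 ×ˢ 𝓝[≠] 0) :=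
    tendsto_id.prodMk tendsto_id
  have h1 := h.comp (hdiag.comp (tendsto_fst (f := 𝓝[≠] (0 : ℝ)) (g := 𝓝[≠] (0 : ℝ))))
  have h2 := h.comp (hdiag.comp (tendsto_snd (f := 𝓝[≠] (0 : ℝ)) (g := 𝓝[≠] (0 : ℝ))))
  have h3 := (h1.sub (h.const_mul 2)).add h2
  have h4 := (Real.continuous_sqrt.tendsto _).comp h3
  rw [show ∀ m : ℝ, m - 2 * m + m = 0 by intro m; ring, Real.sqrt_zero] at h4
  refine h4.congr fun z => ?_
  simp only [Function.comp_apply, real_inner_self_eq_norm_sq]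
  rw [← norm_sub_sq_real, Real.sqrt_sq (norm_nonneg _), dist_eq_norm]

theorem tendsto_featureQuotient (hk : IsC11 k) (hH : IsRKHSOf H k) (i : Fin d) (x : E d) :
    Tendsto (featureQuotient H i x) (𝓝[≠] 0) (𝓝 (featureDeriv H i x)) := by
  have h := hasLineDerivAt_feature hk hH i x
  rw [HasLineDerivAt, hasDerivAt_iff_tendsto_slope_zero] at h
  simp only [zero_add, zero_smul, add_zero] at h
  exact h

theorem inner_featureDeriv_featureDeriv (hk : IsC11 k) (hH : IsRKHSOf H k) (i j : Fin d)
    (x y : E d) :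
    inner ℝ (featureDeriv H i x) (featureDeriv H j y) = partialMixed k i j x y :=
  tendsto_nhds_unique
    (((tendsto_featureQuotient hk hH i x).comp tendsto_fst).inner
      ((tendsto_featureQuotient hk hH j y).comp tendsto_snd))
    (tendsto_inner_featureQuotient hk hH i j x y)

theorem hasLineDerivAt_rkhs (hk : IsC11 k) (hH : IsRKHSOf H k) (f : H) (i : Fin d) (x : E d) :
    HasLineDerivAt ℝ f (inner ℝ f (featureDeriv H i x)) x (stdVec i) := by
  have h := ((innerSL ℝ f).hasFDerivAt.comp_hasDerivAt (0 : ℝ)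
    (hasLineDerivAt_feature hk hH i x :))
  simpa [HasLineDerivAt, Function.comp_def, inner_feature] using h

theorem continuous_featureDeriv (hk : IsC11 k) (hH : IsRKHSOf H k) (i : Fin d) :
    Continuous (featureDeriv H i) := by
  rw [continuous_iff_continuousAt]
  intro x
  have hc := hk.continuous_partialMixed i i
  have h1 : Continuous fun y => partialMixed k i i y y - 2 * partialMixed k i i y x
      + partialMixed k i i x x :=
    ((hc.comp (continuous_id.prodMk continuous_id)).sub
      ((hc.comp (continuous_id.prodMk continuous_const)).const_mul 2)).add continuous_const
  have h2 := (Real.continuous_sqrt.comp h1).tendsto x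
  rw [Function.comp_apply, show ∀ m : ℝ, m - 2 * m + m = 0 by intro m; ring,
    Real.sqrt_zero] at h2
  refine tendsto_iff_dist_tendsto_zero.2 (h2.congr fun y => ?_)
  rw [Function.comp_apply, ← inner_featureDeriv_featureDeriv hk hH,
    ← inner_featureDeriv_featureDeriv hk hH, ← inner_featureDeriv_featureDeriv hk hH,
    real_inner_self_eq_norm_sq, real_inner_self_eq_norm_sq,
    ← norm_sub_sq_real, Real.sqrt_sq (norm_nonneg _), dist_eq_norm]

theorem exists_norm_featureDeriv_le (hk : IsC11 k) (hkb : IsBoundedC11 k) (hH : IsRKHSOf H k) :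
    ∃ M : ℝ, 0 ≤ M ∧ ∀ (i : Fin d) (x : E d), ‖featureDeriv H i x‖ ≤ M := by
  obtain ⟨B, hB⟩ := hkb.bounded_mixed
  refine ⟨√B, Real.sqrt_nonneg _, fun i x => Real.le_sqrt_of_sq_le ?_⟩
  rw [← real_inner_self_eq_norm_sq, inner_featureDeriv_featureDeriv hk hH]
  exact (le_abs_self _).trans (hB i i x x)

theorem exists_norm_feature_le (hkb : IsBoundedC11 k) (hH : IsRKHSOf H k) :
    ∃ M : ℝ, 0 ≤ M ∧ ∀ x : E d, ‖feature H x‖ ≤ M := by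
  obtain ⟨B, hB⟩ := hkb.bounded
  refine ⟨√B, Real.sqrt_nonneg _, fun x => Real.le_sqrt_of_sq_le ?_⟩
  rw [← real_inner_self_eq_norm_sq, hH.inner_feature_feature]
  exact (le_abs_self _).trans (hB x x)

/-- Continuity of `k` itself is not assumed. The bounded partial derivatives make the feature map
Lipschitz along each axis, and moving one coordinate at a time gives continuity. -/
theorem continuous_feature (hk : IsC11 k) (hkb : IsBoundedC11 k) (hH : IsRKHSOf H k) :
    Continuous (feature (d := d) H) := by
  obtain ⟨M, hM0, hM⟩ := exists_norm_featureDeriv_le hk hkb hH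
  have hline : ∀ (i : Fin d) (x : E d) (t : ℝ),
      ‖feature H (x + t • stdVec i) - feature H x‖ ≤ M * |t| := by
    intro i x t
    have h := Convex.norm_image_sub_le_of_norm_hasDerivWithin_le
      (f := fun u : ℝ => feature H (x + u • stdVec i))
      (f' := fun u => featureDeriv H i (x + u • stdVec i)) (s := Set.univ) (x := 0) (y := t)
      (C := M) (fun u _ => (hasDerivAt_line (hasLineDerivAt_feature hk hH i _)).hasDerivWithinAt)
      (fun u _ => hM i _) convex_univ trivial trivial
    simpa using h
  have hsum : ∀ (s : Finset (Fin d)) (x w : E d),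
      ‖feature H (x + ∑ i ∈ s, w i • stdVec i) - feature H x‖ ≤ M * ∑ i ∈ s, |w i| := by
    intro s x w
    induction s using Finset.induction_on with
    | empty => simp
    | insert a s ha ih =>
      rw [Finset.sum_insert ha, Finset.sum_insert ha, add_comm (w a • _), ← add_assoc, mul_add]
      refine (norm_sub_le_norm_sub_add_norm_sub _ (feature H (x + ∑ i ∈ s, w i • stdVec i)) _).trans
        (add_le_add (hline a _ _) ih)
  have hexp : ∀ w : E d, ∑ i, w i • (stdVec i : E d) = w := by
    intro w
    ext j
    simp [Pi.single_apply]
  rw [continuous_iff_continuousAt]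
  intro x
  refine tendsto_iff_dist_tendsto_zero.2 ?_
  have hb : Continuous fun y : E d => M * ∑ i, |(y - x) i| := by fun_prop
  have hb' := hb.tendsto x
  simp only [sub_self, PiLp.zero_apply, abs_zero, Finset.sum_const_zero, mul_zero] at hb'
  refine squeeze_zero (fun _ => dist_nonneg) (fun y => ?_) hb'
  have := hsum Finset.univ x (y - x)
  rwa [hexp, add_sub_cancel, ← dist_eq_norm] at this

end Feature

/-! ### Regularised least squares in a Hilbert space -/

section Ridge

variable {Ω V : Type*} [MeasurableSpace Ω] [NormedAddCommGroup V] [InnerProductSpace ℝ V]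

/-- The regularised least squares objective with features `φ` and targets `g`. -/
def ridge (μ : Measure Ω) (φ : Ω → V) (g : Ω → ℝ) (lam : ℝ) (v : V) : ℝ :=
  (∫ x, (inner ℝ v (φ x) - g x) ^ 2 ∂μ) + lam * ‖v‖ ^ 2

/-- Half the gradient of the regularised least squares objective. -/
def ridgeGrad (μ : Measure Ω) (φ : Ω → V) (g : Ω → ℝ) (lam : ℝ) (v : V) : V :=
  (∫ x, (inner ℝ v (φ x) - g x) • φ x ∂μ) + lam • v

variable {μ : Measure Ω} {φ : Ω → V} {g : Ω → ℝ} {lam : ℝ}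

theorem memLp_residual (hφ : MemLp φ 2 μ) (hg : MemLp g 2 μ) (v : V) :
    MemLp (fun x => inner ℝ v (φ x) - g x) 2 μ :=
  (hφ.const_inner v).sub hg

theorem integrable_residual_smul (hφ : MemLp φ 2 μ) (hg : MemLp g 2 μ) (v : V) :
    Integrable (fun x => (inner ℝ v (φ x) - g x) • φ x) μ :=
  memLp_one_iff_integrable.1 (hφ.smul (memLp_residual hφ hg v))

variable [CompleteSpace V]

/-- The objective is quadratic, so its second-order expansion is exact and no differentiation is
needed. -/
theorem ridge_add (hφ : MemLp φ 2 μ) (hg : MemLp g 2 μ) (v w : V) :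
    ridge μ φ g lam (v + w) = ridge μ φ g lam v + 2 * inner ℝ w (ridgeGrad μ φ g lam v)
      + ((∫ x, (inner ℝ w (φ x)) ^ 2 ∂μ) + lam * ‖w‖ ^ 2) := by
  have h1 := (memLp_residual hφ hg v).integrable_sq
  have h2 := (hφ.const_inner (𝕜 := ℝ) w).integrable_sq
  have h3 := (integrable_residual_smul hφ hg v).const_inner (𝕜 := ℝ) w
  have h13 : Integrable (fun x => (inner ℝ v (φ x) - g x) ^ 2
      + 2 * inner ℝ w ((inner ℝ v (φ x) - g x) • φ x)) μ := h1.add (h3.const_mul 2)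
  have h4 : ∫ x, (inner ℝ (v + w) (φ x) - g x) ^ 2 ∂μ
      = (∫ x, (inner ℝ v (φ x) - g x) ^ 2 ∂μ)
        + 2 * inner ℝ w (∫ x, (inner ℝ v (φ x) - g x) • φ x ∂μ)
        + ∫ x, (inner ℝ w (φ x)) ^ 2 ∂μ := by
    rw [← integral_inner (integrable_residual_smul hφ hg v), ← integral_const_mul,
      ← integral_add h1 (h3.const_mul 2), ← integral_add h13 h2]
    refine integral_congr_ae (Eventually.of_forall fun x => ?_)
    simp only [inner_add_left, inner_smul_right]
    ring
  rw [ridge, ridge, ridgeGrad, h4, inner_add_right, inner_smul_right, norm_add_sq_real,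
    real_inner_comm w v]
  ring

/-- Strong monotonicity: the integral part of the gradient is a positive semi-definite operator, so
pairing the difference with `u - v` leaves at least `lam * ‖u - v‖ ^ 2`; Cauchy–Schwarz finishes. -/
theorem mul_norm_sub_le_ridgeGrad (hφ : MemLp φ 2 μ) (hg : MemLp g 2 μ) (u v : V) :
    lam * ‖u - v‖ ≤ ‖ridgeGrad μ φ g lam u - ridgeGrad μ φ g lam v‖ := by
  have h1 : ridgeGrad μ φ g lam u - ridgeGrad μ φ g lam v
      = (∫ x, inner ℝ (u - v) (φ x) • φ x ∂μ) + lam • (u - v) := by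
    rw [ridgeGrad, ridgeGrad, add_sub_add_comm, ← integral_sub
      (integrable_residual_smul hφ hg u) (integrable_residual_smul hφ hg v), smul_sub]
    congr 1
    refine integral_congr_ae (Eventually.of_forall fun x => ?_)
    simp only [← sub_smul, inner_sub_left]
    congr 1; ring
  have h2 : lam * ‖u - v‖ ^ 2
      ≤ inner ℝ (u - v) (ridgeGrad μ φ g lam u - ridgeGrad μ φ g lam v) := by
    have hint : Integrable (fun x => inner ℝ (u - v) (φ x) • φ x) μ :=
      memLp_one_iff_integrable.1 (hφ.smul (hφ.const_inner (u - v)))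
    rw [h1, inner_add_right, inner_smul_right, real_inner_self_eq_norm_sq,
      ← integral_inner hint]
    refine le_add_of_nonneg_left (integral_nonneg fun x => ?_)
    simp only [inner_smul_right, Pi.zero_apply]
    exact mul_self_nonneg _
  rcases (norm_nonneg (u - v)).eq_or_lt with h0 | h0
  · rw [← h0, mul_zero]; exact norm_nonneg _
  · have h3 := h2.trans (real_inner_le_norm _ _)
    nlinarith

/-- This is the normal equation `T v = ∫ g φ` with `T = ∫ φ ⊗ φ + λ`; coercivity of `T` makes it
invertible. -/
theorem exists_ridgeGrad_eq_zero (hφ : MemLp φ 2 μ) (hg : MemLp g 2 μ) (hlam : 0 < lam) :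
    ∃ v, ridgeGrad μ φ g lam v = 0 := by
  have hgφ : Integrable (fun x => g x • φ x) μ := memLp_one_iff_integrable.1 (hφ.smul hg)
  have hT : Integrable (fun x => InnerProductSpace.rankOne ℝ (φ x) (φ x)) μ := by
    refine Integrable.mono' ((memLp_two_iff_integrable_sq_norm hφ.1).1 hφ) ?_
      (Eventually.of_forall fun x => ?_)
    · have hc : Continuous fun z : V => InnerProductSpace.rankOne ℝ z z :=
        (InnerProductSpace.rankOne ℝ (E := V) (F := V)).continuous₂.comp (continuous_id.prodMk continuous_id)
      exact hc.comp_aestronglyMeasurable hφ.1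
    · simp [sq]
  set T : V →L[ℝ] V := (∫ x, InnerProductSpace.rankOne ℝ (φ x) (φ x) ∂μ)
    + lam • ContinuousLinearMap.id ℝ V with hTdef
  have hTv : ∀ v, T v = (∫ x, inner ℝ v (φ x) • φ x ∂μ) + lam • v := by
    intro v
    simp [hTdef, ContinuousLinearMap.integral_apply hT, InnerProductSpace.rankOne_apply,
      real_inner_comm]
  have hint : ∀ v, Integrable (fun x => inner ℝ v (φ x) • φ x) μ := fun v =>
      memLp_one_iff_integrable.1 (hφ.smul (hφ.const_inner v))
  have hunit : IsUnit T := by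
    refine ContinuousLinearMap.isUnit_of_forall_le_norm_inner_map T (c := ⟨lam, hlam.le⟩) hlam
      fun v => ?_
    refine le_trans ?_ (le_abs_self _)
    rw [real_inner_comm, hTv, inner_add_right, inner_smul_right, real_inner_self_eq_norm_sq,
      ← integral_inner (hint v), mul_comm]
    refine le_add_of_nonneg_left (integral_nonneg fun x => ?_)
    simp only [inner_smul_right, Pi.zero_apply]
    exact mul_self_nonneg _
  obtain ⟨S, hS⟩ := hunit.exists_right_inv
  refine ⟨S (∫ x, g x • φ x ∂μ), ?_⟩
  set v := S (∫ x, g x • φ x ∂μ) with hv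
  have h1 : T v = ∫ x, g x • φ x ∂μ := by
    rw [hv, ← mul_apply_eq_comp, hS, one_apply_eq_self]
  rw [hTv] at h1
  simp only [ridgeGrad, sub_smul]
  rw [integral_sub (hint v) hgφ, ← h1]
  abel

theorem isMinOn_ridge_iff (hφ : MemLp φ 2 μ) (hg : MemLp g 2 μ) (hlam : 0 < lam) {v : V} :
    IsMinOn (ridge μ φ g lam) Set.univ v ↔ ridgeGrad μ φ g lam v = 0 := by
  have hsq : ∀ w : V, 0 ≤ ∫ x, (inner ℝ w (φ x)) ^ 2 ∂μ := fun w =>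
    integral_nonneg fun x => sq_nonneg _
  constructor
  · intro hv
    -- Rather than differentiating at `v`, compare it with a known zero `u` of the gradient: the
    -- expansion around `u` forces `v = u`.
    obtain ⟨u, hu⟩ := exists_ridgeGrad_eq_zero hφ hg hlam
    have h1 := ridge_add (lam := lam) hφ hg u (v - u)
    have h2 : ridge μ φ g lam v ≤ ridge μ φ g lam u := hv (Set.mem_univ u)
    rw [hu, inner_zero_right, add_sub_cancel] at h1
    have h3 : lam * ‖v - u‖ ^ 2 ≤ 0 := by linarith [hsq (v - u)]
    have h4 : ‖v - u‖ = 0 := by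
      by_contra h
      have : 0 < ‖v - u‖ := lt_of_le_of_ne (norm_nonneg _) (Ne.symm h)
      have : 0 < lam * ‖v - u‖ ^ 2 := by positivity
      linarith
    rwa [sub_eq_zero.1 (norm_eq_zero.1 h4)]
  · intro hv w _
    have h1 := ridge_add (lam := lam) hφ hg v (w - v)
    rw [hv, inner_zero_right, add_sub_cancel] at h1
    have : 0 ≤ lam * ‖w - v‖ ^ 2 := by positivity
    simp only [Set.mem_ofPred_eq]
    linarith [hsq (w - v)]

theorem existsUnique_isMinOn_ridge (hφ : MemLp φ 2 μ) (hg : MemLp g 2 μ) (hlam : 0 < lam) :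
    ∃! v, IsMinOn (ridge μ φ g lam) Set.univ v := by
  simp only [isMinOn_ridge_iff hφ hg hlam]
  obtain ⟨v, hv⟩ := exists_ridgeGrad_eq_zero hφ hg hlam
  refine ⟨v, hv, fun u hu => ?_⟩
  have h := mul_norm_sub_le_ridgeGrad (lam := lam) hφ hg u v
  rw [hu, hv, sub_zero, norm_zero] at h
  exact sub_eq_zero.1 (norm_le_zero_iff.1 (nonpos_of_mul_nonpos_right h hlam))

end Ridge

/-! ### Convergence of integrals under Wasserstein convergence -/

section Wasserstein

variable {d : ℕ} {p : ℝ}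

theorem norm_rpow_le_add {V : Type*} [SeminormedAddCommGroup V] (hp : 0 ≤ p) (x y : V) :
    ‖x‖ ^ p ≤ 2 ^ p * (‖y‖ ^ p + ‖x - y‖ ^ p) := by
  have h1 : ‖x‖ ≤ 2 * max ‖y‖ ‖x - y‖ := by
    have h := norm_add_le y (x - y)
    rw [add_sub_cancel] at h
    linarith [le_max_left ‖y‖ ‖x - y‖, le_max_right ‖y‖ ‖x - y‖]
  have h2 := Real.rpow_le_rpow (norm_nonneg x) h1 hp
  rw [Real.mul_rpow (by norm_num) (le_max_of_le_left (norm_nonneg _))] at h2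
  refine h2.trans (mul_le_mul_of_nonneg_left ?_ (by positivity))
  have hy : 0 ≤ ‖y‖ ^ p := by positivity
  have hxy : 0 ≤ ‖x - y‖ ^ p := by positivity
  rcases max_choice ‖y‖ ‖x - y‖ with h | h <;> rw [h] <;> linarith

/-- Large `y` are paid for by the indicator, nearby pairs by uniform continuity on a ball, and
separated pairs by `‖x - y‖ ^ p`. The remainder depends on `y` alone, so under a coupling it is
integrated against the second marginal only. -/
theorem exists_norm_sub_le_of_growth {V F : Type*} [NormedAddCommGroup V] [ProperSpace V]
    [NormedAddCommGroup F] {f : V → F} (hf : Continuous f) (hp : 0 < p) {A : ℝ}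
    (hA : ∀ x, ‖f x‖ ≤ A * (1 + ‖x‖ ^ p)) {ε : ℝ} (hε : 0 < ε) (R : ℝ) :
    ∃ K : ℝ, 0 ≤ K ∧ ∀ x y, ‖f x - f y‖ ≤ K * ‖x - y‖ ^ p
      + (ε + {z : V | R < ‖z‖}.indicator (fun z => A * (2 ^ p + 2) * (1 + ‖z‖ ^ p)) y) := by
  have hA0 : 0 ≤ A := by
    have h := (norm_nonneg _).trans (hA 0)
    rw [norm_zero, Real.zero_rpow hp.ne'] at h
    linarith
  have huc := (isCompact_closedBall (0 : V) (R + 1)).uniformContinuousOn_of_continuous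
    hf.continuousOn
  obtain ⟨δ, hδ, hδ'⟩ := Metric.uniformContinuousOn_iff.1 huc ε hε
  set η := min δ 1 with hη
  have hη0 : 0 < η := lt_min hδ one_pos
  have hηp : 0 < η ^ p := Real.rpow_pos_of_pos hη0 p
  have h2p : (0 : ℝ) < 2 ^ p := by positivity
  have hRp : 0 ≤ |R| ^ p := by positivity
  -- The first summand absorbs the bounded part of `hcrude` when `‖x - y‖ ≥ η`; the second is its
  -- coefficient of `‖x - y‖ ^ p`.
  refine ⟨A * (2 + (2 ^ p + 1) * |R| ^ p) / η ^ p + A * 2 ^ p, by positivity, fun x y => ?_⟩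
  have hyp : 0 ≤ ‖y‖ ^ p := by positivity
  have hxyp : 0 ≤ ‖x - y‖ ^ p := by positivity
  have hcrude : ‖f x - f y‖ ≤ A * (2 + (2 ^ p + 1) * ‖y‖ ^ p) + A * 2 ^ p * ‖x - y‖ ^ p := by
    calc ‖f x - f y‖ ≤ ‖f x‖ + ‖f y‖ := norm_sub_le _ _
      _ ≤ A * (1 + ‖x‖ ^ p) + A * (1 + ‖y‖ ^ p) := add_le_add (hA x) (hA y)
      _ ≤ A * (1 + 2 ^ p * (‖y‖ ^ p + ‖x - y‖ ^ p)) + A * (1 + ‖y‖ ^ p) := by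
        gcongr
        exact norm_rpow_le_add hp.le x y
      _ = _ := by ring
  rw [add_mul]
  have hK : 0 ≤ A * (2 + (2 ^ p + 1) * |R| ^ p) / η ^ p * ‖x - y‖ ^ p := by positivity
  have hK' : 0 ≤ A * 2 ^ p * ‖x - y‖ ^ p := by positivity
  by_cases hy : R < ‖y‖
  · rw [Set.indicator_of_mem (by exact hy)]
    have : A * (2 + (2 ^ p + 1) * ‖y‖ ^ p) ≤ A * (2 ^ p + 2) * (1 + ‖y‖ ^ p) := by
      rw [mul_assoc]
      exact mul_le_mul_of_nonneg_left (by nlinarith) hA0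
    linarith
  · rw [Set.indicator_of_notMem (by exact hy), add_zero]
    rw [not_lt] at hy
    by_cases hxy : ‖x - y‖ < η
    · have hx1 : ‖x‖ ≤ R + 1 := by
        have h := norm_add_le y (x - y)
        rw [add_sub_cancel] at h
        linarith [hxy.trans_le (min_le_right δ 1)]
      have := hδ' x (by simpa using hx1) y (by simpa using hy.trans (by linarith))
        (by rw [dist_eq_norm]; exact hxy.trans_le (min_le_left _ _))
      rw [dist_eq_norm] at this
      linarith
    · rw [not_lt] at hxy
      have h1 : η ^ p ≤ ‖x - y‖ ^ p := Real.rpow_le_rpow hη0.le hxy hp.le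
      have h2 : ‖y‖ ^ p ≤ |R| ^ p :=
        Real.rpow_le_rpow (norm_nonneg _) (hy.trans (le_abs_self R)) hp.le
      have h3 : A * (2 + (2 ^ p + 1) * ‖y‖ ^ p) ≤ A * (2 + (2 ^ p + 1) * |R| ^ p) := by gcongr
      have h4 : A * (2 + (2 ^ p + 1) * |R| ^ p)
          ≤ A * (2 + (2 ^ p + 1) * |R| ^ p) / η ^ p * ‖x - y‖ ^ p := by
        rw [div_mul_eq_mul_div, le_div_iff₀ hηp]
        exact mul_le_mul_of_nonneg_left h1 (by positivity)
      linarith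

theorem integrable_of_growth {F : Type*} [NormedAddCommGroup F] {μ : Measure (E d)} {f : E d → F}
    (hf : Continuous f) {A : ℝ} (hA : ∀ x, ‖f x‖ ≤ A * (1 + ‖x‖ ^ p))
    (hμ : Integrable (fun x => 1 + ‖x‖ ^ p) μ) : Integrable f μ :=
  (hμ.const_mul A).mono' hf.aestronglyMeasurable (Eventually.of_forall hA)

theorem exists_coupling_of_wassersteinDist_lt (hp : 0 < p) {μ ν : Measure (E d)} {η : ENNReal}
    (h : wassersteinDist p μ ν < η) :
    ∃ γ : Measure (E d × E d), γ.map Prod.fst = μ ∧ γ.map Prod.snd = ν ∧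
      ∫⁻ z, ENNReal.ofReal (‖z.1 - z.2‖ ^ p) ∂γ < η ^ p := by
  rw [wassersteinDist, one_div, ENNReal.rpow_inv_lt_iff hp] at h
  simp only [iInf_lt_iff] at h
  obtain ⟨γ, ⟨h1, h2⟩, h3⟩ := h
  exact ⟨γ, h1, h2, h3⟩

theorem integrable_norm_sub_rpow (hp : 0 < p) {γ : Measure (E d × E d)}
    (h : ∫⁻ z, ENNReal.ofReal (‖z.1 - z.2‖ ^ p) ∂γ ≠ ⊤) :
    Integrable (fun z : E d × E d => ‖z.1 - z.2‖ ^ p) γ := by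
  refine (lintegral_ofReal_ne_top_iff_integrable ?_ ?_).1 h
  · exact (Continuous.rpow_const (by fun_prop) fun _ => Or.inr hp.le).aestronglyMeasurable
  · exact Eventually.of_forall fun z => by positivity

/-- A coupling of finite cost transfers the `p`-th moment, so that of the limit measure need not be
assumed. -/
theorem integrable_one_add_norm_rpow_of_wassersteinDist_lt_top (hp : 0 < p)
    {μ ν : Measure (E d)} (hμ : Integrable (fun x => 1 + ‖x‖ ^ p) μ)
    [IsFiniteMeasure ν] (h : wassersteinDist p μ ν < ⊤) :
    Integrable (fun x => 1 + ‖x‖ ^ p) ν := by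
  obtain ⟨γ, h1, h2, h3⟩ := exists_coupling_of_wassersteinDist_lt hp h
  have hc : Continuous fun x : E d => ‖x‖ ^ p :=
    Continuous.rpow_const (by fun_prop) fun _ => Or.inr hp.le
  refine (integrable_const 1).add ?_
  subst h1 h2
  rw [integrable_map_measure (by exact hμ.1) (by fun_prop)] at hμ
  rw [integrable_map_measure hc.aestronglyMeasurable (by fun_prop)]
  refine Integrable.mono' ((hμ.add (integrable_norm_sub_rpow hp h3.ne_top)).const_mul (2 ^ p))
    (hc.comp continuous_snd).aestronglyMeasurable (Eventually.of_forall fun z => ?_)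
  simp only [Function.comp_apply, Pi.add_apply]
  rw [Real.norm_of_nonneg (by positivity)]
  refine (norm_rpow_le_add hp.le z.2 z.1).trans ?_
  rw [norm_sub_rev z.2 z.1]
  gcongr
  linarith

theorem norm_integral_sub_le_of_coupling {F : Type*} [NormedAddCommGroup F] [NormedSpace ℝ F]
    (hp : 0 < p) {γ : Measure (E d × E d)} {f : E d → F} {r : E d → ℝ} {K : ℝ}
    (hf1 : Integrable f (γ.map Prod.fst)) (hf2 : Integrable f (γ.map Prod.snd))
    (hr : Integrable r (γ.map Prod.snd))
    (hγ : ∫⁻ z, ENNReal.ofReal (‖z.1 - z.2‖ ^ p) ∂γ ≠ ⊤)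
    (hfr : ∀ x y, ‖f x - f y‖ ≤ K * ‖x - y‖ ^ p + r y) :
    ‖∫ x, f x ∂(γ.map Prod.fst) - ∫ x, f x ∂(γ.map Prod.snd)‖
      ≤ K * (∫⁻ z, ENNReal.ofReal (‖z.1 - z.2‖ ^ p) ∂γ).toReal + ∫ y, r y ∂(γ.map Prod.snd) := by
  have hi := integrable_norm_sub_rpow hp hγ
  rw [integral_map (by fun_prop) hf1.1, integral_map (by fun_prop) hf2.1,
    integral_map (by fun_prop) hr.1]
  rw [integrable_map_measure (by exact hf1.1) (by fun_prop)] at hf1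
  rw [integrable_map_measure (by exact hf2.1) (by fun_prop)] at hf2
  rw [integrable_map_measure (by exact hr.1) (by fun_prop)] at hr
  simp only [Function.comp_def] at hf1 hf2 hr
  rw [← integral_eq_lintegral_of_nonneg_ae (Eventually.of_forall fun z => by positivity) hi.1,
    ← integral_const_mul, ← integral_sub hf1 hf2]
  refine (norm_integral_le_integral_norm _).trans ?_
  rw [← integral_add (hi.const_mul K) hr]
  exact integral_mono (hf1.sub hf2).norm ((hi.const_mul K).add hr) fun z => hfr z.1 z.2

theorem tendsto_integral_indicator_norm_gt {V : Type*} [NormedAddCommGroup V] [MeasurableSpace V]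
    [OpensMeasurableSpace V] {ν : Measure V} {f : V → ℝ} (hf : Integrable f ν) :
    Tendsto (fun n : ℕ => ∫ y, {z : V | (n : ℝ) < ‖z‖}.indicator f y ∂ν) atTop (𝓝 0) := by
  have hm : ∀ n : ℕ, MeasurableSet {z : V | (n : ℝ) < ‖z‖} := fun n =>
    (isOpen_lt continuous_const continuous_norm).measurableSet
  rw [← integral_zero V ℝ (μ := ν)]
  refine tendsto_integral_of_dominated_convergence (fun y => ‖f y‖)
    (fun n => hf.1.indicator (hm n)) hf.norm
    (fun n => Eventually.of_forall fun y => norm_indicator_le_norm_self _ _)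
    (Eventually.of_forall fun y => ?_)
  refine tendsto_const_nhds.congr' ?_
  filter_upwards [eventually_ge_atTop ⌈‖y‖⌉₊] with n hn
  rw [Set.indicator_of_notMem]
  simpa using Nat.ceil_le.1 hn

/-- Convergence in the `p`-Wasserstein distance implies convergence of the integrals of
continuous functions of growth at most `1 + ‖x‖ ^ p`, with values in a Banach space. -/
theorem tendsto_integral_of_tendsto_wassersteinDist {F : Type*} [NormedAddCommGroup F]
    [NormedSpace ℝ F] (hp : 0 < p) {μ : ℕ → Measure (E d)} {ν : Measure (E d)}
    [IsProbabilityMeasure ν] (hμ : ∀ᶠ n in atTop, Integrable (fun x => 1 + ‖x‖ ^ p) (μ n))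
    (hW : Tendsto (fun n => wassersteinDist p (μ n) ν) atTop (𝓝 0))
    {f : E d → F} (hf : Continuous f) {A : ℝ} (hA : ∀ x, ‖f x‖ ≤ A * (1 + ‖x‖ ^ p)) :
    Tendsto (fun n => ∫ x, f x ∂(μ n)) atTop (𝓝 (∫ x, f x ∂ν)) := by
  have hν : Integrable (fun x => 1 + ‖x‖ ^ p) ν := by
    obtain ⟨n, hn1, hn2⟩ := (hμ.and (hW.eventually_lt_const ENNReal.zero_lt_top)).exists
    exact integrable_one_add_norm_rpow_of_wassersteinDist_lt_top hp hn1 hn2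
  rw [Metric.tendsto_nhds]
  intro ε hε
  have htail := tendsto_integral_indicator_norm_gt (hν.const_mul (A * (2 ^ p + 2)))
  obtain ⟨R, hR⟩ := (htail.eventually_lt_const (show (0 : ℝ) < ε / 3 by positivity)).exists
  obtain ⟨K, hK0, hK⟩ := exists_norm_sub_le_of_growth hf hp hA (show 0 < ε / 3 by positivity) R
  have hm : MeasurableSet {z : E d | (R : ℝ) < ‖z‖} :=
    (isOpen_lt continuous_const continuous_norm).measurableSet
  have hind := (hν.const_mul (A * (2 ^ p + 2))).indicator hm
  -- `R` fixes `K`, and `K` fixes the admissible cost `τ`, with `K * τ ≤ ε / 3` even if `K = 0`. The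
  -- distance carries a `p`-th root, hence the threshold `τ ^ p⁻¹`.
  set τ : ℝ := ε / (3 * (K + 1)) with hτ
  have hτ0 : 0 < τ := by positivity
  have hη : (0 : ENNReal) < ENNReal.ofReal (τ ^ p⁻¹) := by
    rw [ENNReal.ofReal_pos]; positivity
  filter_upwards [hμ, hW.eventually_lt_const hη] with n hn1 hn2
  obtain ⟨γ, h1, h2, h3⟩ := exists_coupling_of_wassersteinDist_lt hp hn2
  rw [ENNReal.ofReal_rpow_of_nonneg (by positivity) hp.le, ← Real.rpow_mul hτ0.le,
    inv_mul_cancel₀ hp.ne', Real.rpow_one] at h3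
  have hcost : (∫⁻ z, ENNReal.ofReal (‖z.1 - z.2‖ ^ p) ∂γ).toReal ≤ τ :=
    ENNReal.toReal_le_of_le_ofReal hτ0.le h3.le
  have hb := norm_integral_sub_le_of_coupling hp (γ := γ) (f := f)
    (h1 ▸ integrable_of_growth hf hA hn1) (h2 ▸ integrable_of_growth hf hA hν)
    (h2 ▸ (integrable_const (ε / 3)).add hind) h3.ne_top hK
  rw [h1, h2] at hb
  rw [integral_add (integrable_const _) hind, integral_const, probReal_univ, one_smul] at hb
  rw [dist_eq_norm]
  have hKτ : K * (∫⁻ z, ENNReal.ofReal (‖z.1 - z.2‖ ^ p) ∂γ).toReal ≤ ε / 3 := by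
    refine (mul_le_mul_of_nonneg_left hcost hK0).trans ?_
    rw [hτ, mul_div_assoc', div_le_div_iff₀ (by positivity) (by positivity)]
    nlinarith
  linarith

end Wasserstein

/-! ### Empirical measures -/

section Empirical

variable {d : ℕ} {F : Type*} [NormedAddCommGroup F]

theorem integrable_empiricalMeasure (X : ℕ → E d) {N : ℕ} (hN : 1 ≤ N) (f : E d → F) :
    Integrable f (empiricalMeasure X N) := by
  have hN0 : (N : ENNReal) ≠ 0 := by exact_mod_cast (by omega : N ≠ 0)
  refine Integrable.smul_measure ?_ (ENNReal.inv_ne_top.2 hN0)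
  rw [integrable_finsetSum_measure]
  exact fun i _ => integrable_dirac (by simp)

theorem integral_empiricalMeasure [NormedSpace ℝ F] [CompleteSpace F] (X : ℕ → E d) (N : ℕ)
    (f : E d → F) :
    ∫ x, f x ∂(empiricalMeasure X N) = (1 / (N : ℝ)) • ∑ i ∈ Finset.range N, f (X i) := by
  rw [empiricalMeasure, integral_smul_measure,
    integral_finsetSum_measure fun i _ => integrable_dirac (by simp)]
  simp

theorem memLp_two_empiricalMeasure (X : ℕ → E d) {N : ℕ} (hN : 1 ≤ N) (f : E d → F) :
    MemLp f 2 (empiricalMeasure X N) :=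
  (memLp_two_iff_integrable_sq_norm (integrable_empiricalMeasure X hN f).1).2
    (integrable_empiricalMeasure X hN _)

end Empirical

/-! ### The Stein operator as a feature expansion -/

section Stein

variable {d : ℕ} {H : Type*} [NormedAddCommGroup H] [InnerProductSpace ℝ H]
  [CompleteSpace H] [RKHS ℝ H (E d) ℝ] {k : E d → E d → ℝ} {ρ : E d → ℝ}

variable (H) in
/-- The representer of the functional `v ↦ (S v)(x)` on `Hᵈ`. -/
def steinFeature (ρ : E d → ℝ) (x : E d) : Hd d H :=
  WithLp.toLp 2 fun i => score ρ x i • feature H x + featureDeriv H i x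

theorem steinOp_toField (hk : IsC11 k) (hH : IsRKHSOf H k) (v : Hd d H) (x : E d) :
    steinOp ρ (toField v) x = inner ℝ v (steinFeature H ρ x) := by
  rw [PiLp.inner_apply, steinOp, divergence, PiLp.inner_apply, ← Finset.sum_add_distrib]
  refine Finset.sum_congr rfl fun i _ => ?_
  have h := (hasLineDerivAt_rkhs hk hH (v i) i x).lineDeriv
  simp only [steinFeature, toField, inner_add_right, inner_smul_right, inner_feature, h]
  simp [mul_comm]

theorem IsPosC1Density.continuous_score (hρ : IsPosC1Density ρ) : Continuous (score ρ) := by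
  have h1 : ContDiff ℝ 1 fun y => Real.log (ρ y) := hρ.contDiff.log fun x => (hρ.pos x).ne'
  exact (InnerProductSpace.toDual ℝ (E d)).symm.continuous.comp (h1.continuous_fderiv one_ne_zero)

theorem IsPosC1Density.isProbabilityMeasure (hρ : IsPosC1Density ρ) :
    IsProbabilityMeasure (densityMeasure ρ) :=
  ⟨by rw [densityMeasure, withDensity_apply _ MeasurableSet.univ, Measure.restrict_univ,
    hρ.lintegral_eq_one]⟩

theorem continuous_steinFeature (hk : IsC11 k) (hkb : IsBoundedC11 k) (hH : IsRKHSOf H k)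
    (hρ : IsPosC1Density ρ) : Continuous (steinFeature H ρ) := by
  have h1 := continuous_feature hk hkb hH
  have h2 := hρ.continuous_score
  refine (PiLp.continuous_toLp 2 _).comp (continuous_pi fun i => ?_)
  have h3 := continuous_featureDeriv hk hH i
  fun_prop

theorem exists_norm_steinFeature_le (hk : IsC11 k) (hkb : IsBoundedC11 k) (hH : IsRKHSOf H k) :
    ∃ M : ℝ, 0 ≤ M ∧ ∀ x, ‖steinFeature H ρ x‖ ≤ M * (1 + ‖score ρ x‖) := by
  obtain ⟨M₁, hM₁, h₁⟩ := exists_norm_featureDeriv_le hk hkb hH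
  obtain ⟨M₀, hM₀, h₀⟩ := exists_norm_feature_le hkb hH
  refine ⟨√d * (M₀ + M₁), by positivity, fun x => ?_⟩
  have hi : ∀ i, ‖steinFeature H ρ x i‖ ≤ (M₀ + M₁) * (1 + ‖score ρ x‖) := by
    intro i
    calc ‖score ρ x i • feature H x + featureDeriv H i x‖
        ≤ ‖score ρ x i‖ * ‖feature H x‖ + ‖featureDeriv H i x‖ :=
          (norm_add_le _ _).trans_eq (by rw [norm_smul])
      _ ≤ ‖score ρ x‖ * M₀ + M₁ := by
          gcongr
          · exact PiLp.norm_apply_le _ i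
          · exact h₀ x
          · exact h₁ i x
      _ ≤ _ := by nlinarith [norm_nonneg (score ρ x)]
  have hb : 0 ≤ (M₀ + M₁) * (1 + ‖score ρ x‖) := by positivity
  rw [PiLp.norm_eq_of_L2, mul_assoc, Real.sqrt_le_left (by positivity), mul_pow,
    Real.sq_sqrt (Nat.cast_nonneg d)]
  refine (Finset.sum_le_sum fun i _ => pow_le_pow_left₀ (norm_nonneg _) (hi i) 2).trans_eq ?_
  simp

end Stein

/-! ### Separating the mean of the target from the gradient -/

section Ridge

variable {Ω V : Type*} [MeasurableSpace Ω] [NormedAddCommGroup V] [InnerProductSpace ℝ V]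

/-- The subtracted mean varies with the measure; splitting it off leaves integrands that do not. -/
theorem ridgeGrad_sub_const {μ : Measure Ω} {φ : Ω → V} {g : Ω → ℝ} {v : V} (lam m : ℝ)
    (h1 : Integrable (fun x => (inner ℝ v (φ x) - g x) • φ x) μ) (h2 : Integrable φ μ) :
    ridgeGrad μ φ (fun x => g x - m) lam v
      = (∫ x, (inner ℝ v (φ x) - g x) • φ x ∂μ) + m • (∫ x, φ x ∂μ) + lam • v := by
  rw [ridgeGrad, ← integral_smul, ← integral_add h1 (h2.fun_smul m)]
  congr 2
  funext x
  rw [← add_smul]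
  congr 1; ring

end Ridge

/-! ### Convergence of the gradient at a fixed vector -/

section Convergence

variable {d : ℕ} {V : Type*} [NormedAddCommGroup V] [InnerProductSpace ℝ V]
  {p : ℝ} {φ : E d → V} {h : E d → ℝ} {A : ℝ}

theorem sq_one_add_rpow_half_le (a p : ℝ) (ha : 0 ≤ a) :
    (1 + a ^ (p / 2)) ^ 2 ≤ 2 * (1 + a ^ p) := by
  have : (a ^ (p / 2)) ^ 2 = a ^ p := by
    rw [← Real.rpow_natCast, ← Real.rpow_mul ha]; norm_num
  nlinarith [sq_nonneg (1 - a ^ (p / 2))]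

theorem one_add_rpow_half_le (a p : ℝ) (ha : 0 ≤ a) : 1 + a ^ (p / 2) ≤ 2 * (1 + a ^ p) := by
  have h1 := sq_one_add_rpow_half_le a p ha
  have h2 : 0 ≤ a ^ (p / 2) := by positivity
  nlinarith

theorem memLp_two_of_growth {F : Type*} [NormedAddCommGroup F] {μ : Measure (E d)} {f : E d → F}
    (hf : Continuous f) (hA : ∀ x, ‖f x‖ ≤ A * (1 + ‖x‖ ^ (p / 2)))
    (hμ : Integrable (fun x => 1 + ‖x‖ ^ p) μ) : MemLp f 2 μ := by
  rw [memLp_two_iff_integrable_sq_norm hf.aestronglyMeasurable]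
  refine integrable_of_growth (p := p) (A := A ^ 2 * 2) (by fun_prop) (fun x => ?_) hμ
  rw [Real.norm_of_nonneg (by positivity), mul_assoc]
  refine (pow_le_pow_left₀ (norm_nonneg _) (hA x) 2).trans ?_
  rw [mul_pow]
  exact mul_le_mul_of_nonneg_left (sq_one_add_rpow_half_le _ _ (norm_nonneg x)) (sq_nonneg A)

theorem tendsto_ridgeGrad [CompleteSpace V] (hp : 0 < p) {μ : ℕ → Measure (E d)}
    {ν : Measure (E d)} [IsProbabilityMeasure ν]
    (hμ : ∀ᶠ n in atTop, Integrable (fun x => 1 + ‖x‖ ^ p) (μ n))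
    (hν : Integrable (fun x => 1 + ‖x‖ ^ p) ν)
    (hW : Tendsto (fun n => wassersteinDist p (μ n) ν) atTop (𝓝 0))
    (hφ : Continuous φ) (hh : Continuous h) (hA : 0 ≤ A)
    (hφA : ∀ x, ‖φ x‖ ≤ A * (1 + ‖x‖ ^ (p / 2))) (hhA : ∀ x, ‖h x‖ ≤ A * (1 + ‖x‖ ^ (p / 2)))
    (lam : ℝ) (v : V) :
    Tendsto (fun n => ridgeGrad (μ n) φ (fun x => h x - ∫ y, h y ∂(μ n)) lam v) atTop
      (𝓝 (ridgeGrad ν φ (fun x => h x - ∫ y, h y ∂ν) lam v)) := by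
  have hlin : ∀ x : E d, A * (1 + ‖x‖ ^ (p / 2)) ≤ A * 2 * (1 + ‖x‖ ^ p) := fun x => by
    rw [mul_assoc]
    exact mul_le_mul_of_nonneg_left (one_add_rpow_half_le _ _ (norm_nonneg x)) hA
  have hφA' : ∀ x, ‖φ x‖ ≤ A * 2 * (1 + ‖x‖ ^ p) := fun x => (hφA x).trans (hlin x)
  have hhA' : ∀ x, ‖h x‖ ≤ A * 2 * (1 + ‖x‖ ^ p) := fun x => (hhA x).trans (hlin x)
  have hc : Continuous fun x => (inner ℝ v (φ x) - h x) • φ x := by fun_prop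
  -- Both factors have growth exponent `p / 2`, so their product has exactly the exponent `p` that
  -- Wasserstein convergence controls.
  have hcA : ∀ x, ‖(inner ℝ v (φ x) - h x) • φ x‖
      ≤ (‖v‖ + 1) * A ^ 2 * 2 * (1 + ‖x‖ ^ p) := by
    intro x
    set b := 1 + ‖x‖ ^ (p / 2) with hb
    have hb0 : 0 ≤ b := by positivity
    have h1 : ‖inner ℝ v (φ x) - h x‖ ≤ (‖v‖ + 1) * (A * b) := by
      calc ‖inner ℝ v (φ x) - h x‖ ≤ ‖inner ℝ v (φ x)‖ + ‖h x‖ := norm_sub_le _ _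
        _ ≤ ‖v‖ * (A * b) + A * b := add_le_add
            ((norm_inner_le_norm _ _).trans
              (mul_le_mul_of_nonneg_left (hφA x) (norm_nonneg v))) (hhA x)
        _ = _ := by ring
    calc ‖(inner ℝ v (φ x) - h x) • φ x‖ = ‖inner ℝ v (φ x) - h x‖ * ‖φ x‖ := norm_smul _ _
      _ ≤ (‖v‖ + 1) * (A * b) * (A * b) := by
          refine mul_le_mul h1 (hφA x) (norm_nonneg _) (by positivity)
      _ = (‖v‖ + 1) * A ^ 2 * b ^ 2 := by ring
      _ ≤ (‖v‖ + 1) * A ^ 2 * (2 * (1 + ‖x‖ ^ p)) := by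
          gcongr
          exact sq_one_add_rpow_half_le _ _ (norm_nonneg x)
      _ = _ := by ring
  have t1 := tendsto_integral_of_tendsto_wassersteinDist hp hμ hW hc hcA
  have t2 := tendsto_integral_of_tendsto_wassersteinDist hp hμ hW hφ hφA'
  have t3 := tendsto_integral_of_tendsto_wassersteinDist hp hμ hW hh hhA'
  rw [ridgeGrad_sub_const lam _ (integrable_of_growth hc hcA hν)
    (integrable_of_growth hφ hφA' hν)]
  refine ((t1.add (t3.smul t2)).add_const (lam • v)).congr' ?_
  filter_upwards [hμ] with n hn
  rw [ridgeGrad_sub_const lam _ (integrable_of_growth hc hcA hn)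
    (integrable_of_growth hφ hφA' hn)]

end Convergence

/-! ### The two objectives as ridge functionals -/

section Objective

variable {d : ℕ} {H : Type*} [NormedAddCommGroup H] [InnerProductSpace ℝ H]
  [CompleteSpace H] [RKHS ℝ H (E d) ℝ] {k : E d → E d → ℝ}

theorem meanFieldObjective_eq_ridge (hk : IsC11 k) (hH : IsRKHSOf H k) (ρ h : E d → ℝ)
    (lam : ℝ) :
    meanFieldObjective (H := H) ρ h lam = ridge (densityMeasure ρ) (steinFeature H ρ)
      (fun x => h x - ∫ y, h y ∂(densityMeasure ρ)) lam := by
  funext v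
  simp only [meanFieldObjective, ridge, steinOp_toField hk hH]

theorem sampleObjective_eq_ridge (hk : IsC11 k) (hH : IsRKHSOf H k) (ρ h : E d → ℝ)
    (X : ℕ → E d) (N : ℕ) (lam : ℝ) :
    sampleObjective (H := H) ρ h X N lam = ridge (empiricalMeasure X N) (steinFeature H ρ)
      (fun x => h x - ∫ y, h y ∂(empiricalMeasure X N)) lam := by
  funext v
  simp only [sampleObjective, ridge, steinOp_toField hk hH, integral_empiricalMeasure,
    smul_eq_mul]

end Objective

end SteinTransport
end

open SteinTransport in
theorem theorem1 {d : ℕ} {H : Type*} [NormedAddCommGroup H] [InnerProductSpace ℝ H]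
    [CompleteSpace H] [RKHS ℝ H (E d) ℝ]
    (ρ h : E d → ℝ) (k : E d → E d → ℝ)
    (hk : IsPosDefKernel k) (hk11 : IsC11 k) (hkb : IsBoundedC11 k) (hH : IsRKHSOf H k)
    (hρ : IsPosC1Density ρ)
    (hh : Continuous h)
    (hhL2 : MemLp h 2 (densityMeasure ρ))
    (hsL2 : MemLp (score ρ) 2 (densityMeasure ρ))
    (C p : ℝ) (hC : 0 < C) (hp : 1 < p)
    (hs_growth : ∀ x, ‖score ρ x‖ ≤ C * (1 + ‖x‖ ^ (p / 2)))
    (hh_growth : ∀ x, |h x| ≤ C * (1 + ‖x‖ ^ (p / 2)))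
    (X : ℕ → E d)
    (hX : Tendsto (fun N => wassersteinDist p (empiricalMeasure X N) (densityMeasure ρ))
      atTop (𝓝 0))
    (lam : ℝ) (hlam : 0 < lam) :
    (∃! v : Hd d H, IsMinOn (meanFieldObjective ρ h lam) Set.univ v) ∧
    (∀ N : ℕ, 1 ≤ N → ∃! v : Hd d H, IsMinOn (sampleObjective ρ h X N lam) Set.univ v) ∧
    ∀ (vInf : Hd d H) (vN : ℕ → Hd d H),
      IsMinOn (meanFieldObjective ρ h lam) Set.univ vInf →
      (∀ N : ℕ, 1 ≤ N → IsMinOn (sampleObjective ρ h X N lam) Set.univ (vN N)) →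
      Tendsto (fun N => ‖vN N - vInf‖) atTop (𝓝 0) := by
  have hp0 : 0 < p := by linarith
  have := hρ.isProbabilityMeasure
  have hμ : ∀ᶠ N in atTop, Integrable (fun x => 1 + ‖x‖ ^ p) (empiricalMeasure X N) := by
    filter_upwards [eventually_ge_atTop 1] with N hN
    exact integrable_empiricalMeasure X hN _
  have hν : Integrable (fun x => 1 + ‖x‖ ^ p) (densityMeasure ρ) := by
    obtain ⟨N, hN1, hN2⟩ := (hμ.and (hX.eventually_lt_const ENNReal.zero_lt_top)).exists
    exact integrable_one_add_norm_rpow_of_wassersteinDist_lt_top hp0 hN1 hN2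
  have hφ := continuous_steinFeature hk11 hkb hH hρ
  obtain ⟨M, hM0, hM⟩ := exists_norm_steinFeature_le (ρ := ρ) hk11 hkb hH
  -- One constant for both bounds: `M * (1 + C)` serves the features and `C` serves `h`.
  set A : ℝ := M * (1 + C) + C with hA
  have hA0 : 0 ≤ A := by positivity
  have hφA : ∀ x, ‖steinFeature H ρ x‖ ≤ A * (1 + ‖x‖ ^ (p / 2)) := by
    intro x
    have ha : 0 ≤ ‖x‖ ^ (p / 2) := by positivity
    calc ‖steinFeature H ρ x‖ ≤ M * (1 + C * (1 + ‖x‖ ^ (p / 2))) :=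
          (hM x).trans (by gcongr; exact hs_growth x)
      _ ≤ M * ((1 + C) * (1 + ‖x‖ ^ (p / 2))) := by gcongr; linarith
      _ = M * (1 + C) * (1 + ‖x‖ ^ (p / 2)) := by ring
      _ ≤ A * (1 + ‖x‖ ^ (p / 2)) := by gcongr; linarith
  have hhA : ∀ x, ‖h x‖ ≤ A * (1 + ‖x‖ ^ (p / 2)) := fun x =>
    (hh_growth x).trans (by gcongr; rw [hA]; nlinarith)
  have hφ2 : MemLp (steinFeature H ρ) 2 (densityMeasure ρ) := memLp_two_of_growth hφ hφA hν
  have hg2 : MemLp (fun x => h x - ∫ y, h y ∂(densityMeasure ρ)) 2 (densityMeasure ρ) :=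
    hhL2.sub (memLp_const _)
  simp only [meanFieldObjective_eq_ridge hk11 hH, sampleObjective_eq_ridge hk11 hH]
  refine ⟨existsUnique_isMinOn_ridge hφ2 hg2 hlam, fun N hN => existsUnique_isMinOn_ridge
    (memLp_two_empiricalMeasure X hN _) (memLp_two_empiricalMeasure X hN _) hlam,
    fun vInf vN hInf hvN => ?_⟩
  rw [isMinOn_ridge_iff hφ2 hg2 hlam] at hInf
  -- The empirical gradients at the fixed vector `vInf` tend to its mean-field gradient, which is
  -- zero.
  have ht := (tendsto_ridgeGrad hp0 hμ hν hX hφ hh hA0 hφA hhA lam vInf).norm.const_mul lam⁻¹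
  rw [hInf, norm_zero, mul_zero] at ht
  refine squeeze_zero' (Eventually.of_forall fun N => norm_nonneg _) ?_ ht
  filter_upwards [eventually_ge_atTop 1] with N hN
  have hφN := memLp_two_empiricalMeasure X hN (steinFeature H ρ)
  have hgN := memLp_two_empiricalMeasure X hN
    fun x => h x - ∫ y, h y ∂(empiricalMeasure X N)
  have h1 := mul_norm_sub_le_ridgeGrad (lam := lam) hφN hgN (vN N) vInf
  rw [(isMinOn_ridge_iff hφN hgN hlam).1 (hvN N hN), zero_sub, norm_neg] at h1
  rwa [le_inv_mul_iff₀ hlam]
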